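/- Let $\mathbb N=\{1,2,3,\dots\}$ and $\mathbb T=\mathbb R/\mathbb Z$, and let $\mathcal F$ be the set of all finite non-empty subsets of $\mathbb N$. For an $\mathcal F$-indexed family $(z_\alpha)_{\alpha\in\mathcal F}$ of complex numbers and $z\in\mathbb C$, write $\operatorname{IP-lim}_{\alpha\in\mathcal F} z_\alpha=z$ if for every $\epsilon>0$ there is $k_\epsilon\in\mathbb N$ such that $|z_\alpha-z|<\epsilon$ whenever $\alpha\in\mathcal F$ and $\min\alpha>k_\epsilon$. For a sequence $(n_k)_{k\in\mathbb N}$ in $\mathbb N$ and $\alpha\in\mathcal F$ put $n_\alpha=\sum_{k\in\alpha}n_k$. For a subgroup $H$ of $\mathbb Z^N$ let $$A_H=\{(y_1,\dots,y_N)\in\mathbb T^N : e^{2\pi i\sum_{j=1}^N a_jy_j}=1\text{ for all }(a_1,\dots,a_N)\in H\}$$ be its annihilator, and let $\lambda_H$ be the normalized Haar measure of the compact group $A_H$, regarded as a Borel probability measure on $\mathbb T^N$. Let $d,N\in\mathbb N$ with $d<N$ and let $G$ be a finite-index subgroup of $\mathbb Z^d$. Then there exist a Borel probability measure $\sigma$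 on $\mathbb T$ and a strictly increasing sequence $(n_k)_{k\in\mathbb N}$ in $\mathbb N$ such that for every continuous $f:\mathbb T^N\to\mathbb C$ and every Borel measurable $E\subseteq\mathbb T$, $$\operatorname{IP-lim}_{\alpha\in\mathcal F}\int_{\mathbb T}\mathbf 1_E(x)\,f(n_\alpha x,n_\alpha^2x,\dots,n_\alpha^Nx)\,d\sigma(x)=\sigma(E)\int_{\mathbb T^N}f\,d\lambda_{G\times\{\vec 0\}},$$ where $\vec 0\in\mathbb Z^{N-d}$, so that $G\times\{\vec 0\}$ is a subgroup of $\mathbb Z^N$. -/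

import Mathlib

open MeasureTheory

noncomputable section

namespace IPRigidity

/-- The set `𝓕` of finite non-empty subsets of the index set `ℕ`. -/
abbrev FinNonempty : Type := {α : Finset ℕ // α.Nonempty}

/-- `IP-lim_{α ∈ 𝓕} x α = L`: for every `ε > 0` there is `k` such that `dist (x α) L < ε`
whenever `min α > k`. -/
def HasIPLim {X : Type*} [PseudoMetricSpace X] (x : FinNonempty → X) (L : X) : Prop :=
  ∀ ε : ℝ, 0 < ε → ∃ k : ℕ, ∀ α : FinNonempty, k < α.1.min' α.2 → dist (x α) L < ε

/-- The finite sum `n_α = ∑_{k ∈ α} n_k`. -/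
def ipSum (n : ℕ → ℕ) (α : FinNonempty) : ℕ := ∑ k ∈ α.1, n k

/-- The torus `𝕋^N`, where `𝕋 = ℝ/ℤ`. -/
abbrev Torus (N : ℕ) : Type := Fin N → UnitAddCircle

/-- The subgroup `G × {0}` of `ℤ^N`, for a subgroup `G` of `ℤ^d` and `d ≤ N`: the first `d`
coordinates form an element of `G` and the remaining `N - d` coordinates vanish. -/
def prodZero {d N : ℕ} (h : d ≤ N) (G : AddSubgroup (Fin d → ℤ)) : AddSubgroup (Fin N → ℤ) where
  carrier := {a | (fun i : Fin d => a (Fin.castLE h i)) ∈ G ∧ ∀ j : Fin N, d ≤ (j : ℕ) → a j = 0}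
  zero_mem' := ⟨G.zero_mem, fun _ _ => rfl⟩
  add_mem' := fun {a b} ha hb =>
    ⟨G.add_mem ha.1 hb.1, fun j hj => by simp [ha.2 j hj, hb.2 j hj]⟩
  neg_mem' := fun {a} ha => ⟨G.neg_mem ha.1, fun j hj => by simp [ha.2 j hj]⟩

/-- The annihilator `A_H ⊆ 𝕋^N` of a subgroup `H` of `ℤ^N`: all `y` such that
`exp (2πi ∑ j, a j * y j) = 1` for every `a ∈ H`. -/
def annihilator {N : ℕ} (H : AddSubgroup (Fin N → ℤ)) : AddSubgroup (Torus N) where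
  carrier := {y | ∀ a ∈ H, AddCircle.toCircle (∑ j, a j • y j) = 1}
  zero_mem' := fun a _ => by simp
  add_mem' := fun {y z} hy hz a ha => by
    simp [smul_add, Finset.sum_add_distrib, AddCircle.toCircle_add, hy a ha, hz a ha]
  neg_mem' := fun {y} hy a ha => by
    simp [Finset.sum_neg_distrib, AddCircle.toCircle_neg, hy a ha]

theorem isClosed_annihilator {N : ℕ} (H : AddSubgroup (Fin N → ℤ)) :
    IsClosed (annihilator H : Set (Torus N)) := by
  have h : (annihilator H : Set (Torus N)) =
      ⋂ a ∈ H, {y : Torus N | AddCircle.toCircle (∑ j, a j • y j) = 1} := by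
    ext y
    simp [annihilator]
  rw [h]
  refine isClosed_biInter fun a _ => isClosed_eq ?_ continuous_const
  exact AddCircle.continuous_toCircle.comp
    (continuous_finsetSum _ fun j _ => (continuous_apply j).zsmul (a j))

instance compactSpace_annihilator {N : ℕ} (H : AddSubgroup (Fin N → ℤ)) :
    CompactSpace (annihilator H) :=
  isCompact_iff_compactSpace.mp (isClosed_annihilator H).isCompact

/-- The normalized Haar measure `λ_H` of the compact group `A_H`, regarded as a Borel measure
on `𝕋^N`. -/
def haarAnnihilator {N : ℕ} (H : AddSubgroup (Fin N → ℤ)) : Measure (Torus N) :=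
  (Measure.addHaarMeasure (⊤ : TopologicalSpace.PositiveCompacts (annihilator H))).map
    (Subtype.val : annihilator H → Torus N)

end IPRigidity

end

noncomputable section

namespace IPRigidity

open Filter Topology Polynomial

/-! Put H = G × {0}. The measure σ is the law mod 1 of a random series ∑ x_k with independent terms.
The k-th term encodes a uniform character ψ_k of ℤ^N / (H + n_k ℤ^N): its base-n_k digits are placed
so that (n_k x_k, …, n_k^N x_k) is close mod 1 to the torus point of ψ_k.

By density of trigonometric polynomials it suffices to treat a product of characters e(mx) and e(∑
a_j y_j). Its integral is E e(P(n_α) ∑ x_k), where P has constant term m and higher coefficients a.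
By independence this is the product over k of E e(P(n_α) x_k). As n_k^(N+1) divides later terms and
n_k^(N+1) x_k is an integer, only n_α mod n_k^(N+1) matters, namely c + n_k or c, with c the sum of
the terms of α before k. If k ∈ α, then e(P(c + n_k) x_k) is close to ψ_k at the coefficients of the
Taylor shift of P by c (`norm_expChar_eval_sub_le`). Since the index of G divides c, this shift does
not affect membership in H (`coeffVec_taylor_mem_iff`).

If a ∈ H, then after removal of the constant term every factor is nearly 1, with summable errors
supported on k ≥ min α, so the limit is the m-th Fourier coefficient of σ. If a ∉ H, the single
factor at k = max α tends to 0 by orthogonality of characters. This matches the Fourier coefficients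
of λ_H, which form the indicator function of H. -/

/-! ### The exponential character on the reals -/

/-- The additive character `t ↦ exp (2πit)` of `ℝ`. -/
def expChar (t : ℝ) : ℂ := Complex.exp (2 * Real.pi * t * Complex.I)

theorem expChar_add (s t : ℝ) : expChar (s + t) = expChar s * expChar t := by
  simp only [expChar, ← Complex.exp_add]
  push_cast
  ring_nf

@[simp] theorem expChar_zero : expChar 0 = 1 := by simp [expChar]

theorem expChar_int (k : ℤ) : expChar k = 1 := by
  rw [expChar, ← Complex.exp_int_mul_two_pi_mul_I k]
  push_cast
  ring_nf

theorem expChar_eq_of_sub_int {s t : ℝ} (k : ℤ) (h : s = t + k) : expChar s = expChar t := by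
  rw [h, expChar_add, expChar_int, mul_one]

@[simp] theorem norm_expChar (t : ℝ) : ‖expChar t‖ = 1 := by
  have h : (2 * Real.pi * t * Complex.I : ℂ) = ((2 * Real.pi * t : ℝ) : ℂ) * Complex.I := by
    push_cast; ring
  rw [expChar, h, Complex.norm_exp_ofReal_mul_I]

theorem norm_expChar_sub_one_le (t : ℝ) : ‖expChar t - 1‖ ≤ 2 * Real.pi * |t| := by
  have h : (2 * Real.pi * t * Complex.I : ℂ) = Complex.I * ((2 * Real.pi * t : ℝ) : ℂ) := by
    push_cast; ring
  rw [expChar, h]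
  refine (Real.norm_exp_I_mul_ofReal_sub_one_le).trans ?_
  rw [Real.norm_eq_abs, abs_mul, abs_of_pos Real.two_pi_pos]

theorem continuous_expChar : Continuous expChar := by
  unfold expChar; fun_prop

theorem expChar_sum {ι : Type*} (s : Finset ι) (t : ι → ℝ) :
    expChar (∑ i ∈ s, t i) = ∏ i ∈ s, expChar (t i) := by
  classical
  induction s using Finset.induction_on with
  | empty => simp
  | insert i s hi ih => rw [Finset.sum_insert hi, Finset.prod_insert hi, expChar_add, ih]

/-- Turns errors of single factors into an error of the product, with no loss because the factors
are unimodular. -/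
theorem norm_prod_sub_one_le {ι : Type*} (s : Finset ι) (z : ι → ℂ) (hz : ∀ i ∈ s, ‖z i‖ = 1) :
    ‖∏ i ∈ s, z i - 1‖ ≤ ∑ i ∈ s, ‖z i - 1‖ := by
  classical
  induction s using Finset.induction_on with
  | empty => simp
  | insert i s hi ih =>
    rw [Finset.prod_insert hi, Finset.sum_insert hi]
    have h : z i * ∏ j ∈ s, z j - 1 = z i * (∏ j ∈ s, z j - 1) + (z i - 1) := by ring
    rw [h, add_comm (‖z i - 1‖)]
    refine (norm_add_le _ _).trans (add_le_add ?_ le_rfl)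
    rw [norm_mul, hz i (Finset.mem_insert_self i s), one_mul]
    exact ih fun j hj => hz j (Finset.mem_insert_of_mem hj)

/-! ### Integer polynomials and their Taylor shifts -/

/-- The sum of the absolute values of the coefficients of degree at most `N`. -/
def coeffNorm (N : ℕ) (P : ℤ[X]) : ℝ := ∑ b ∈ Finset.range (N + 1), |(P.coeff b : ℝ)|

theorem abs_coeff_le_coeffNorm {N b : ℕ} (hb : b ≤ N) (P : ℤ[X]) :
    |(P.coeff b : ℝ)| ≤ coeffNorm N P :=
  Finset.single_le_sum (f := fun b => |(P.coeff b : ℝ)|) (fun _ _ => abs_nonneg _)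
    (Finset.mem_range.2 (Nat.lt_succ_of_le hb))

theorem coeffNorm_nonneg (N : ℕ) (P : ℤ[X]) : 0 ≤ coeffNorm N P :=
  Finset.sum_nonneg fun _ _ => abs_nonneg _

theorem abs_eval_le_coeffNorm {N : ℕ} {P : ℤ[X]} (hP : P.natDegree ≤ N) (c : ℤ) :
    |((P.eval c : ℤ) : ℝ)| ≤ coeffNorm N P * (1 + |(c : ℝ)|) ^ N := by
  rw [eval_eq_sum_range' (Nat.lt_succ_of_le hP), coeffNorm, Finset.sum_mul]
  push_cast
  refine (Finset.abs_sum_le_sum_abs _ _).trans (Finset.sum_le_sum fun b hb => ?_)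
  rw [abs_mul, abs_pow]
  refine mul_le_mul_of_nonneg_left ?_ (abs_nonneg _)
  have h1 : (1 : ℝ) ≤ 1 + |(c : ℝ)| := by linarith [abs_nonneg (c : ℝ)]
  calc |(c : ℝ)| ^ b ≤ (1 + |(c : ℝ)|) ^ b :=
        pow_le_pow_left₀ (abs_nonneg _) (by linarith) b
    _ ≤ _ := pow_le_pow_right₀ h1 (Nat.lt_succ_iff.1 (Finset.mem_range.1 hb))

/-- Each Taylor coefficient is a Hasse derivative evaluated at `c`, hence a polynomial in `c` of
degree at most `N`. -/
theorem exists_coeffNorm_taylor_le {N : ℕ} {P : ℤ[X]} (hP : P.natDegree ≤ N) :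
    ∃ C : ℝ, 0 ≤ C ∧ ∀ c : ℤ, coeffNorm N (taylor c P) ≤ C * (1 + |(c : ℝ)|) ^ N := by
  refine ⟨∑ b ∈ Finset.range (N + 1), coeffNorm N (hasseDeriv b P),
    Finset.sum_nonneg fun _ _ => coeffNorm_nonneg _ _, fun c => ?_⟩
  rw [coeffNorm, Finset.sum_mul]
  refine Finset.sum_le_sum fun b _ => ?_
  rw [taylor_coeff]
  refine abs_eval_le_coeffNorm ((natDegree_hasseDeriv_le P b).trans ?_) c
  omega

theorem dvd_coeff_taylor_sub {m c : ℤ} (h : m ∣ c) (P : ℤ[X]) (b : ℕ) :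
    m ∣ (taylor c P).coeff b - P.coeff b := by
  obtain ⟨k, rfl⟩ := h
  rw [taylor_coeff, ← taylor_zero P, taylor_coeff, taylor_zero]
  exact (Dvd.intro _ rfl : m ∣ m * k).trans (by simpa using sub_dvd_eval_sub (m * k) 0 (hasseDeriv b P))

/-- The coefficients of degree `1, …, N` of a polynomial. -/
def coeffVec (N : ℕ) (P : ℤ[X]) : Fin N → ℤ := fun j => P.coeff (j + 1)

/-- The vanishing coefficients force degree at most `d`, which a shift preserves. The lower
coefficients change by multiples of `c`, hence by an element of `G.index • ℤ^d ⊆ G`. -/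
theorem coeffVec_taylor_mem {d N : ℕ} (h : d ≤ N) {G : AddSubgroup (Fin d → ℤ)} {c : ℤ}
    (hc : (G.index : ℤ) ∣ c) {P : ℤ[X]} (hP : P.natDegree ≤ N)
    (hmem : coeffVec N P ∈ prodZero h G) : coeffVec N (taylor c P) ∈ prodZero h G := by
  obtain ⟨h1, h2⟩ := hmem
  have hdeg : P.natDegree ≤ d := by
    rw [natDegree_le_iff_coeff_eq_zero]
    intro b hb
    by_cases hbN : b ≤ N
    · have := h2 ⟨b - 1, by omega⟩ (by simp only; omega)
      simpa [coeffVec, Nat.sub_add_cancel (show 1 ≤ b by omega)] using this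
    · exact coeff_eq_zero_of_natDegree_lt (by omega)
  constructor
  · choose k hk using fun i : Fin d => dvd_coeff_taylor_sub hc P (i + 1)
    have : (fun i : Fin d => coeffVec N (taylor c P) (Fin.castLE h i)) =
        (fun i : Fin d => coeffVec N P (Fin.castLE h i)) + G.index • k := by
      funext i
      have := hk i
      rw [Pi.add_apply, Pi.smul_apply, nsmul_eq_mul]
      simp only [coeffVec, Fin.val_castLE]
      linarith
    rw [this]
    exact G.add_mem h1 (G.nsmul_index_mem k)
  · intro j hj
    exact coeff_eq_zero_of_natDegree_lt (by rw [natDegree_taylor]; omega)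

theorem coeffVec_taylor_mem_iff {d N : ℕ} (h : d ≤ N) {G : AddSubgroup (Fin d → ℤ)} {c : ℤ}
    (hc : (G.index : ℤ) ∣ c) {P : ℤ[X]} (hP : P.natDegree ≤ N) :
    coeffVec N (taylor c P) ∈ prodZero h G ↔ coeffVec N P ∈ prodZero h G := by
  refine ⟨fun hm => ?_, coeffVec_taylor_mem h hc hP⟩
  have := coeffVec_taylor_mem h (hc.neg_right) (by rwa [natDegree_taylor]) hm
  rwa [taylor_taylor, neg_add_cancel, taylor_zero] at this

/-! ### Characters of the finite quotients -/

/-- The subgroup `H + n ℤ^N`. -/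
abbrev thicken {N : ℕ} (H : AddSubgroup (Fin N → ℤ)) (n : ℕ) : AddSubgroup (Fin N → ℤ) :=
  H ⊔ (nsmulAddMonoidHom n : (Fin N → ℤ) →+ (Fin N → ℤ)).range

theorem nsmul_mem_thicken {N : ℕ} (H : AddSubgroup (Fin N → ℤ)) (n : ℕ) (a : Fin N → ℤ) :
    n • a ∈ thicken H n :=
  le_sup_right (a := H) ⟨a, rfl⟩

/-- Passing to the finite quotient loses nothing for vectors with small entries: `n ℤ^d` already
lies in `G`, and a multiple of `n` of absolute value below `n` is zero. -/
theorem mem_of_mem_thicken {d N : ℕ} (h : d ≤ N) {G : AddSubgroup (Fin d → ℤ)} {n : ℕ}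
    (hn : G.index ∣ n) {a : Fin N → ℤ} (ha : ∀ j, |a j| < n)
    (hmem : a ∈ thicken (prodZero h G) n) : a ∈ prodZero h G := by
  obtain ⟨b, ⟨hb1, hb2⟩, _, ⟨z, rfl⟩, rfl⟩ := AddSubgroup.mem_sup.1 hmem
  obtain ⟨m, rfl⟩ := hn
  constructor
  · refine G.add_mem hb1 ?_
    have := G.nsmul_index_mem (m • fun i : Fin d => z (Fin.castLE h i))
    rw [smul_smul] at this
    exact this
  · intro j hj
    refine Int.eq_zero_of_abs_lt_dvd (m := ((G.index * m : ℕ) : ℤ)) ?_ (ha j)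
    simp [hb2 j hj]

/-- A finitely generated abelian group killed by `n` is finite. -/
instance finite_quotient_thicken {N : ℕ} (H : AddSubgroup (Fin N → ℤ)) (n : ℕ) [NeZero n] :
    Finite ((Fin N → ℤ) ⧸ thicken H n) := by
  refine AddCommGroup.finite_of_fg_isAddTorsion _ fun x => ?_
  obtain ⟨a, rfl⟩ := QuotientAddGroup.mk_surjective x
  rw [isOfFinAddOrder_iff_nsmul_eq_zero]
  refine ⟨n, NeZero.pos n, ?_⟩
  rw [← QuotientAddGroup.mk_nsmul, QuotientAddGroup.eq_zero_iff]
  exact nsmul_mem_thicken H n a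

/-- The characters of `ℤ^N ⧸ (H + n ℤ^N)`. -/
abbrev DualMod {N : ℕ} (H : AddSubgroup (Fin N → ℤ)) (n : ℕ) : Type :=
  AddChar ((Fin N → ℤ) ⧸ thicken H n) ℂ

/-- A character is determined by its values on the basis vectors, and these are `n`-th roots of
unity because `n` kills the quotient. -/
theorem exists_residue {N : ℕ} {H : AddSubgroup (Fin N → ℤ)} {n : ℕ} [NeZero n]
    (ψ : DualMod H n) :
    ∃ r : Fin N → ℕ, (∀ j, r j < n) ∧
      ∀ a : Fin N → ℤ, ψ (a : (Fin N → ℤ) ⧸ thicken H n) = expChar (∑ j, a j * (r j / n : ℝ)) := by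
  classical
  let Q := (Fin N → ℤ) ⧸ thicken H n
  have hζ := Complex.isPrimitiveRoot_exp n (NeZero.ne n)
  have key : ∀ j : Fin N, ∃ i < n, expChar (i / n : ℝ) = ψ ((Pi.single j 1 : Fin N → ℤ) : Q) := by
    intro j
    have hpow : ψ ((Pi.single j 1 : Fin N → ℤ) : Q) ^ n = 1 := by
      rw [← AddChar.map_nsmul_eq_pow, ← QuotientAddGroup.mk_nsmul,
        (QuotientAddGroup.eq_zero_iff _).2 (nsmul_mem_thicken H n _), AddChar.map_zero_eq_one]
    obtain ⟨i, hi, h⟩ := hζ.eq_pow_of_pow_eq_one hpow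
    refine ⟨i, hi, ?_⟩
    rw [← h, expChar, ← Complex.exp_nat_mul]
    push_cast
    ring_nf
  choose r hr hr' using key
  refine ⟨r, hr, fun a => ?_⟩
  have ha : (a : Q) = ∑ j, a j • ((Pi.single j 1 : Fin N → ℤ) : Q) := by
    have : a = ∑ j, a j • (Pi.single j 1 : Fin N → ℤ) := by
      funext i; simp [Finset.sum_apply, Pi.single_apply]
    conv_lhs => rw [this]
    rw [← QuotientAddGroup.mk'_apply, map_sum]
    simp
  have hsum : ∀ (s : Finset (Fin N)) (x : Fin N → Q), ψ (∑ j ∈ s, x j) = ∏ j ∈ s, ψ (x j) :=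
    fun s x => map_prod ψ.toMonoidHom (fun j => Multiplicative.ofAdd (x j)) s
  rw [ha, hsum, expChar_sum]
  refine Finset.prod_congr rfl fun j _ => ?_
  rw [AddChar.map_zsmul_eq_zpow, ← hr', expChar, expChar, ← Complex.exp_int_mul]
  push_cast
  ring_nf

/-- The residues `r j < n` such that `ψ` maps the `j`-th basis vector to `exp (2πi r j / n)`. -/
def residue {N : ℕ} {H : AddSubgroup (Fin N → ℤ)} {n : ℕ} [NeZero n] (ψ : DualMod H n) :
    Fin N → ℕ := (exists_residue ψ).choose

theorem residue_lt {N : ℕ} {H : AddSubgroup (Fin N → ℤ)} {n : ℕ} [NeZero n] (ψ : DualMod H n)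
    (j : Fin N) : residue ψ j < n := (exists_residue ψ).choose_spec.1 j

theorem apply_eq_expChar_residue {N : ℕ} {H : AddSubgroup (Fin N → ℤ)} {n : ℕ} [NeZero n]
    (ψ : DualMod H n) (a : Fin N → ℤ) :
    ψ (a : (Fin N → ℤ) ⧸ thicken H n) = expChar (∑ j, a j * (residue ψ j / n : ℝ)) :=
  (exists_residue ψ).choose_spec.2 a

/-- The real number `x = ∑ j, r j / n ^ (j + 2)`, for which `(n x, n² x, …, n^N x)` is close modulo
`1` to the point of the torus that corresponds to `ψ`. -/
def digitPoint {N : ℕ} {H : AddSubgroup (Fin N → ℤ)} {n : ℕ} [NeZero n] (ψ : DualMod H n) : ℝ :=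
  ∑ j : Fin N, (residue ψ j : ℝ) / (n : ℝ) ^ ((j : ℕ) + 2)

section digitPoint

variable {N : ℕ} {H : AddSubgroup (Fin N → ℤ)} {n : ℕ} [NeZero n] (ψ : DualMod H n)

theorem digitPoint_nonneg : 0 ≤ digitPoint ψ := Finset.sum_nonneg fun _ _ => by positivity

theorem residue_div_le (j : Fin N) (m : ℕ) :
    (residue ψ j : ℝ) / (n : ℝ) ^ (m + 2) ≤ 1 / n := by
  have hn : (1 : ℝ) ≤ n := by exact_mod_cast NeZero.one_le
  have hr : (residue ψ j : ℝ) ≤ n := by exact_mod_cast (residue_lt ψ j).le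
  rw [div_le_div_iff₀ (by positivity) (by positivity), one_mul]
  calc (residue ψ j : ℝ) * n ≤ n * n := by gcongr
    _ = (n : ℝ) ^ 2 := by ring
    _ ≤ (n : ℝ) ^ (m + 2) := pow_le_pow_right₀ hn (by omega)

theorem digitPoint_le : digitPoint ψ ≤ N / n := by
  refine (Finset.sum_le_sum fun j _ => residue_div_le ψ j j).trans ?_
  simp [div_eq_mul_inv]

theorem exists_int_pow_mul_digitPoint :
    ∃ k : ℤ, (n : ℝ) ^ (N + 1) * digitPoint ψ = k := by
  have hn : (n : ℝ) ≠ 0 := by exact_mod_cast NeZero.ne n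
  refine ⟨∑ j : Fin N, (residue ψ j : ℤ) * (n : ℤ) ^ (N - 1 - (j : ℕ)), ?_⟩
  rw [digitPoint, Finset.mul_sum]
  push_cast
  refine Finset.sum_congr rfl fun j _ => ?_
  have : N + 1 = (N - 1 - (j : ℕ)) + ((j : ℕ) + 2) := by omega
  rw [this, pow_add]
  field_simp

/-- Multiplication by `n ^ (b + 1)` makes the digits before `b` integral, turns digit `b` into
`residue ψ b / n`, and leaves each later digit at most `1 / n`. -/
theorem exists_pow_mul_digitPoint (b : Fin N) :
    ∃ (k : ℤ) (θ : ℝ), |θ| ≤ N / n ∧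
      (n : ℝ) ^ ((b : ℕ) + 1) * digitPoint ψ = k + residue ψ b / n + θ := by
  classical
  have hn : (n : ℝ) ≠ 0 := by exact_mod_cast NeZero.ne n
  have key : ∀ i : Fin N, ∃ (k : ℤ) (θ : ℝ), |θ| ≤ 1 / n ∧
      (n : ℝ) ^ ((b : ℕ) + 1) * ((residue ψ i : ℝ) / (n : ℝ) ^ ((i : ℕ) + 2)) =
        k + (if i = b then (residue ψ b / n : ℝ) else 0) + θ := by
    intro i
    rcases lt_trichotomy (i : ℕ) (b : ℕ) with h | h | h
    · refine ⟨(residue ψ i : ℤ) * (n : ℤ) ^ ((b : ℕ) - 1 - i), 0, by simp, ?_⟩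
      have hb : (b : ℕ) + 1 = ((b : ℕ) - 1 - i) + ((i : ℕ) + 2) := by omega
      rw [if_neg (by rintro rfl; exact lt_irrefl _ h), hb, pow_add]
      push_cast
      field_simp
      simp
    · obtain rfl := Fin.ext h
      refine ⟨0, 0, by simp, ?_⟩
      rw [if_pos rfl, pow_succ _ ((i : ℕ) + 1)]
      field_simp
      simp
    · refine ⟨0, (residue ψ i : ℝ) / (n : ℝ) ^ ((i : ℕ) - b - 1 + 2), ?_, ?_⟩
      · rw [abs_of_nonneg (by positivity)]
        exact residue_div_le ψ i _
      · have hb : (i : ℕ) + 2 = ((i : ℕ) - b - 1 + 2) + ((b : ℕ) + 1) := by omega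
        have hib : i ≠ b := by rintro rfl; exact lt_irrefl _ h
        rw [if_neg hib, hb, pow_add _ _ ((b : ℕ) + 1)]
        field_simp
        simp
  choose k θ hθ h using key
  refine ⟨∑ i, k i, ∑ i, θ i, ?_, ?_⟩
  · refine (Finset.abs_sum_le_sum_abs _ _).trans ((Finset.sum_le_sum fun i _ => hθ i).trans ?_)
    simp [div_eq_mul_inv]
  · rw [digitPoint, Finset.mul_sum, Finset.sum_congr rfl fun i _ => h i]
    simp [Finset.sum_add_distrib]

/-- Expanding `P` in powers of `n`, the integer parts vanish mod 1 and the residue parts assemble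
into ψ. What remains is the digit errors and `P.coeff 0 * digitPoint ψ`, all of order `1 / n`. -/
theorem norm_expChar_eval_sub_le {P : ℤ[X]} (hP : P.natDegree ≤ N) :
    ‖expChar ((P.eval (n : ℤ) : ℤ) * digitPoint ψ) -
        ψ (coeffVec N P : (Fin N → ℤ) ⧸ thicken H n)‖ ≤ 2 * Real.pi * N * coeffNorm N P / n := by
  choose k θ hθ h using exists_pow_mul_digitPoint ψ
  have hsum : ((P.eval (n : ℤ) : ℤ) : ℝ) * digitPoint ψ =
      (∑ j : Fin N, (coeffVec N P j : ℝ) * (residue ψ j / n : ℝ)) +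
        (P.coeff 0 * digitPoint ψ + ∑ j : Fin N, (coeffVec N P j : ℝ) * θ j) +
        ((∑ j : Fin N, coeffVec N P j * k j : ℤ) : ℝ) := by
    rw [eval_eq_sum_range' (Nat.lt_succ_of_le hP), Finset.sum_range_succ']
    push_cast
    rw [add_mul, Finset.sum_range fun i => (P.coeff (i + 1) : ℝ) * (n : ℝ) ^ (i + 1),
      Finset.sum_mul]
    have : ∀ j : Fin N, (P.coeff ((j : ℕ) + 1) : ℝ) * (n : ℝ) ^ ((j : ℕ) + 1) * digitPoint ψ =
        coeffVec N P j * (residue ψ j / n : ℝ) + coeffVec N P j * θ j +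
          coeffVec N P j * (k j : ℝ) := by
      intro j
      rw [mul_assoc, h j, coeffVec]
      ring
    rw [Finset.sum_congr rfl fun j _ => this j, Finset.sum_add_distrib, Finset.sum_add_distrib]
    ring
  rw [expChar_eq_of_sub_int _ hsum, expChar_add, ← apply_eq_expChar_residue]
  set z := ψ (coeffVec N P : (Fin N → ℤ) ⧸ thicken H n) with hz
  have hznorm : ‖z‖ = 1 := by rw [hz, apply_eq_expChar_residue, norm_expChar]
  rw [show ∀ w : ℂ, z * w - z = z * (w - 1) from fun w => by ring, norm_mul, hznorm, one_mul]
  refine (norm_expChar_sub_one_le _).trans ?_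
  rw [mul_assoc (2 * Real.pi), mul_div_assoc]
  refine mul_le_mul_of_nonneg_left ?_ Real.two_pi_pos.le
  rw [coeffNorm, Finset.sum_range_succ', mul_div_right_comm, mul_add,
    Finset.sum_range fun i => |(P.coeff (i + 1) : ℝ)|, Finset.mul_sum, add_comm]
  refine (abs_add_le _ _).trans (add_le_add ?_ ?_)
  · refine (Finset.abs_sum_le_sum_abs _ _).trans (Finset.sum_le_sum fun j _ => ?_)
    rw [abs_mul, mul_comm]
    exact mul_le_mul_of_nonneg_right (hθ j) (abs_nonneg _)
  · rw [abs_mul, mul_comm, abs_of_nonneg (digitPoint_nonneg ψ)]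
    exact mul_le_mul_of_nonneg_right (digitPoint_le ψ) (abs_nonneg _)

end digitPoint

/-! ### The IP filter -/

/-- The filter on the finite non-empty sets along which `min α → ∞`. -/
def ipFilter : Filter FinNonempty := comap (fun α => α.1.min' α.2) atTop

theorem hasIPLim_iff_tendsto {X : Type*} [PseudoMetricSpace X] {x : FinNonempty → X} {L : X} :
    HasIPLim x L ↔ Tendsto x ipFilter (𝓝 L) := by
  rw [Metric.tendsto_nhds]
  refine forall₂_congr fun ε _ => ?_
  rw [ipFilter, eventually_comap, eventually_atTop]
  constructor
  · rintro ⟨k, hk⟩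
    -- The definition asks for `k < min α`, while `atTop` gives `b ≤ min α`; hence the shift by one.
    exact ⟨k + 1, fun b hb α hα => hk α (by omega)⟩
  · rintro ⟨k, hk⟩
    exact ⟨k, fun α hα => hk _ hα.le α rfl⟩

theorem tendsto_min'_ipFilter :
    Tendsto (fun α : FinNonempty => α.1.min' α.2) ipFilter atTop := tendsto_comap

theorem tendsto_max'_ipFilter :
    Tendsto (fun α : FinNonempty => α.1.max' α.2) ipFilter atTop :=
  tendsto_atTop_mono (fun α => α.1.min'_le_max' α.2) tendsto_min'_ipFilter

/-! ### The uniform measure on the characters -/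

instance measurableSpaceDualMod {N : ℕ} (H : AddSubgroup (Fin N → ℤ)) (n : ℕ) :
    MeasurableSpace (DualMod H n) := ⊤

instance measurableSingletonClassDualMod {N : ℕ} (H : AddSubgroup (Fin N → ℤ)) (n : ℕ) :
    MeasurableSingletonClass (DualMod H n) := ⟨fun _ => trivial⟩

instance fintypeDualMod {N : ℕ} (H : AddSubgroup (Fin N → ℤ)) (n : ℕ) [NeZero n] :
    Fintype (DualMod H n) := Fintype.ofFinite _

/-- The uniform probability measure on the characters of `ℤ^N ⧸ (H + n ℤ^N)`. -/
def dualMeasure {N : ℕ} (H : AddSubgroup (Fin N → ℤ)) (n : ℕ) [NeZero n] :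
    Measure (DualMod H n) := (PMF.uniformOfFintype (DualMod H n)).toMeasure

instance isProbabilityMeasure_dualMeasure {N : ℕ} (H : AddSubgroup (Fin N → ℤ)) (n : ℕ)
    [NeZero n] : IsProbabilityMeasure (dualMeasure H n) := by
  unfold dualMeasure; infer_instance

theorem integral_dualMeasure_apply {N : ℕ} {H : AddSubgroup (Fin N → ℤ)} {n : ℕ} [NeZero n]
    {a : Fin N → ℤ} (ha : a ∉ thicken H n) :
    ∫ ψ : DualMod H n, ψ (a : (Fin N → ℤ) ⧸ thicken H n) ∂(dualMeasure H n) = 0 := by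
  rw [dualMeasure, PMF.integral_eq_sum]
  simp only [PMF.uniformOfFintype_apply]
  rw [← Finset.smul_sum, AddChar.sum_apply_eq_zero_iff_ne_zero.2, smul_zero]
  rwa [Ne, QuotientAddGroup.eq_zero_iff]

/-! ### The random series -/

section series

variable {N : ℕ} (H : AddSubgroup (Fin N → ℤ)) (n : ℕ → ℕ) [∀ k, NeZero (n k)]

/-- The law of a sequence of independent uniform characters. -/
def sequenceMeasure : Measure (∀ k, DualMod H (n k)) :=
  Measure.infinitePi fun k => dualMeasure H (n k)

instance isProbabilityMeasure_sequenceMeasure : IsProbabilityMeasure (sequenceMeasure H n) := by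
  unfold sequenceMeasure; infer_instance

variable {H n}

/-- The sum of the random points attached to a sequence of characters. -/
def digitSum (ω : ∀ k, DualMod H (n k)) : ℝ := ∑' k, digitPoint (ω k)

theorem measurable_digitPoint_apply (k : ℕ) :
    Measurable fun ω : (∀ k, DualMod H (n k)) => digitPoint (ω k) :=
  (measurable_from_top (f := fun ψ : DualMod H (n k) => digitPoint ψ)).comp (measurable_pi_apply k)

variable (hn : Summable fun k => (1 : ℝ) / n k)
include hn

theorem hasSum_digitSum (ω : ∀ k, DualMod H (n k)) :
    HasSum (fun k => digitPoint (ω k)) (digitSum ω) := by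
  refine (Summable.of_nonneg_of_le (fun k => digitPoint_nonneg _)
    (fun k => digitPoint_le (ω k)) ?_).hasSum
  simpa [div_eq_mul_inv] using hn.mul_left (N : ℝ)

theorem measurable_digitSum : Measurable (digitSum : (∀ k, DualMod H (n k)) → ℝ) := by
  refine measurable_of_tendsto_metrizable
    (f := fun K (ω : ∀ k, DualMod H (n k)) => ∑ k ∈ Finset.range K, digitPoint (ω k))
    (fun K => Finset.measurable_sum _ fun k _ => measurable_digitPoint_apply k) ?_
  rw [tendsto_pi_nhds]
  exact fun ω => (hasSum_digitSum hn ω).tendsto_sum_nat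

theorem tendsto_prod_expChar (q : ℤ) (ω : ∀ k, DualMod H (n k)) :
    Tendsto (fun K => ∏ k ∈ Finset.range K, expChar (q * digitPoint (ω k))) atTop
      (𝓝 (expChar (q * digitSum ω))) := by
  have h := ((hasSum_digitSum hn ω).mul_left (q : ℝ)).tendsto_sum_nat
  refine ((continuous_expChar.tendsto _).comp h).congr fun K => ?_
  simp [expChar_sum]

/-- Independence factors the integral of each partial product, and all factors other than the `l`-th
have norm at most 1. The bound survives the limit of partial products. -/
theorem norm_integral_expChar_digitSum_le (q : ℤ) (l : ℕ) :
    ‖∫ ω, expChar (q * digitSum ω) ∂(sequenceMeasure H n)‖ ≤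
      ‖∫ ψ, expChar (q * digitPoint ψ) ∂(dualMeasure H (n l))‖ := by
  have hmeas : ∀ k, Measurable fun ω : (∀ k, DualMod H (n k)) => expChar (q * digitPoint (ω k)) :=
    fun k => continuous_expChar.measurable.comp ((measurable_digitPoint_apply k).const_mul _)
  have hlim : Tendsto (fun K => ∫ ω, ∏ k ∈ Finset.range K, expChar (q * digitPoint (ω k))
      ∂(sequenceMeasure H n)) atTop (𝓝 (∫ ω, expChar (q * digitSum ω) ∂(sequenceMeasure H n))) := by
    refine tendsto_integral_of_dominated_convergence (fun _ => 1)
      (fun K => (Finset.measurable_prod _ fun k _ => hmeas k).aestronglyMeasurable)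
      (integrable_const _) (fun K => Eventually.of_forall fun ω => ?_)
      (Eventually.of_forall fun ω => tendsto_prod_expChar hn q ω)
    simp
  refine le_of_tendsto hlim.norm ?_
  filter_upwards [eventually_gt_atTop l] with K hK
  have hprod : ∫ ω, ∏ k ∈ Finset.range K, expChar (q * digitPoint (ω k)) ∂(sequenceMeasure H n) =
      ∏ k : Finset.range K, ∫ ψ, expChar (q * digitPoint ψ) ∂(dualMeasure H (n k)) := by
    rw [← integral_fintype_prod_eq_prod (μ := fun k : Finset.range K => dualMeasure H (n k))
        (fun k : Finset.range K => fun ψ : DualMod H (n k) => expChar (q * digitPoint ψ)),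
      ← integral_restrict_infinitePi (μ := fun k => dualMeasure H (n k)) (s := Finset.range K)
        (f := fun ω => ∏ k : Finset.range K, expChar (q * digitPoint (ω k)))]
    · refine integral_congr_ae (Eventually.of_forall fun ω => ?_)
      exact (Finset.prod_coe_sort (Finset.range K) fun k => expChar (q * digitPoint (ω k))).symm
    · refine (Finset.measurable_prod _ fun k _ => ?_).aestronglyMeasurable
      exact (measurable_from_top (f := fun ψ : DualMod H (n k) => expChar (q * digitPoint ψ))).comp
        (measurable_pi_apply k)
  rw [hprod, norm_prod,
    Finset.prod_coe_sort (Finset.range K)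
      fun k => ‖∫ ψ, expChar (q * digitPoint ψ) ∂(dualMeasure H (n k))‖,
    ← Finset.mul_prod_erase _ _ (Finset.mem_range.2 hK)]
  refine mul_le_of_le_one_right (norm_nonneg _)
    (Finset.prod_le_one (fun _ _ => norm_nonneg _) fun k _ => ?_)
  refine (norm_integral_le_integral_norm _).trans ?_
  simp

end series

/-! ### Fourier coefficients along IP sums -/

/-- The ratio `(1 + n_0 + ⋯ + n_{k-1}) ^ N / n_k`, which measures how fast `n` grows. -/
def growthRatio (N : ℕ) (n : ℕ → ℕ) (k : ℕ) : ℝ :=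
  (1 + ∑ i ∈ Finset.range k, (n i : ℝ)) ^ N / n k

section ipSum

variable {d N : ℕ} {h : d ≤ N} {G : AddSubgroup (Fin d → ℤ)} {n : ℕ → ℕ}

theorem summable_one_div_of_growthRatio (hs : Summable (growthRatio N n)) :
    Summable fun k => (1 : ℝ) / n k := by
  refine Summable.of_nonneg_of_le (fun k => by positivity) (fun k => ?_) hs
  rw [growthRatio]
  gcongr
  exact one_le_pow₀ (le_add_of_nonneg_right (by positivity))

/-- The sum of the terms `n i` with `i ∈ α` and `i < k`. -/
def initialSum (n : ℕ → ℕ) (α : Finset ℕ) (k : ℕ) : ℤ := ∑ i ∈ α with i < k, (n i : ℤ)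

theorem abs_initialSum_le (α : Finset ℕ) (k : ℕ) :
    |(initialSum n α k : ℝ)| ≤ ∑ i ∈ Finset.range k, (n i : ℝ) := by
  rw [initialSum]
  push_cast
  rw [abs_of_nonneg (by positivity)]
  exact Finset.sum_le_sum_of_subset_of_nonneg
    (fun i hi => Finset.mem_range.2 (Finset.mem_filter.1 hi).2) (fun _ _ _ => by positivity)

theorem coeffNorm_taylor_initialSum_le {P : ℤ[X]} {C : ℝ} (hC : 0 ≤ C)
    (hP : ∀ c : ℤ, coeffNorm N (taylor c P) ≤ C * (1 + |(c : ℝ)|) ^ N) (α : Finset ℕ) (k : ℕ) :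
    coeffNorm N (taylor (initialSum n α k) P) / n k ≤ C * growthRatio N n k := by
  rw [growthRatio, ← mul_div_assoc]
  gcongr
  refine (hP _).trans ?_
  gcongr
  exact abs_initialSum_le α k

/-- Terms of α before `k` form `initialSum`, the term at `k` is the conditional one, and all later
terms are divisible by `n k ^ (N + 1)`. -/
theorem dvd_ipSum_sub (hdiv : ∀ k i, k < i → n k ^ (N + 1) ∣ n i) (α : Finset ℕ) (k : ℕ) :
    ((n k : ℤ) ^ (N + 1)) ∣
      (∑ i ∈ α, (n i : ℤ)) - (initialSum n α k + if k ∈ α then (n k : ℤ) else 0) := by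
  have hk : (if k ∈ α then (n k : ℤ) else 0) = ∑ i ∈ α, if i = k then (n i : ℤ) else 0 := by
    rw [Finset.sum_ite_eq']
  rw [initialSum, Finset.sum_filter, hk, ← Finset.sum_add_distrib, ← Finset.sum_sub_distrib]
  refine Finset.dvd_sum fun i _ => ?_
  rcases lt_trichotomy i k with hik | hik | hik
  · simp [hik, hik.ne]
  · simp [hik]
  · rw [if_neg (by omega), if_neg (by omega)]
    simpa using (by exact_mod_cast hdiv k i hik : (n k : ℤ) ^ (N + 1) ∣ (n i : ℤ))

theorem index_dvd_initialSum (hidx : ∀ k, G.index ∣ n k) (α : Finset ℕ) (k : ℕ) :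
    (G.index : ℤ) ∣ initialSum n α k :=
  Finset.dvd_sum fun i _ => by exact_mod_cast hidx i

theorem initialSum_of_le_min' (α : FinNonempty) {k : ℕ} (hk : k ≤ α.1.min' α.2) :
    initialSum n α.1 k = 0 := by
  rw [initialSum, Finset.filter_false_of_mem, Finset.sum_empty]
  exact fun i hi => not_lt.2 (hk.trans (α.1.min'_le i hi))

variable [∀ k, NeZero (n k)]

theorem expChar_eval_ipSum {H : AddSubgroup (Fin N → ℤ)}
    (hdiv : ∀ k i, k < i → n k ^ (N + 1) ∣ n i) (α : Finset ℕ) (k : ℕ)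
    (ψ : DualMod H (n k)) (P : ℤ[X]) :
    expChar ((P.eval (∑ i ∈ α, (n i : ℤ)) : ℤ) * digitPoint ψ) =
      expChar ((P.eval (initialSum n α k + if k ∈ α then (n k : ℤ) else 0) : ℤ) *
        digitPoint ψ) := by
  obtain ⟨m, hm⟩ := (dvd_ipSum_sub hdiv α k).trans (sub_dvd_eval_sub _ _ P)
  obtain ⟨z, hz⟩ := exists_int_pow_mul_digitPoint ψ
  refine expChar_eq_of_sub_int (m * z) ?_
  rw [sub_eq_iff_eq_add.1 hm]
  push_cast
  rw [← hz]
  ring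

/-- For `k ∈ α` the shifted coefficients lie in `prodZero h G`, so ψ equals 1 there. For `k ∉ α`
only `P(c) * digitPoint ψ` is left, and `P(c)` is the constant Taylor coefficient at `c`. -/
theorem norm_expChar_eval_ipSum_sub_one_le (hdiv : ∀ k i, k < i → n k ^ (N + 1) ∣ n i)
    (hidx : ∀ k, G.index ∣ n k) {P : ℤ[X]} (hP : P.natDegree ≤ N)
    (hmem : coeffVec N P ∈ prodZero h G) (α : Finset ℕ) (k : ℕ)
    (ψ : DualMod (prodZero h G) (n k)) :
    ‖expChar ((P.eval (∑ i ∈ α, (n i : ℤ)) : ℤ) * digitPoint ψ) - 1‖ ≤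
      2 * Real.pi * N * (coeffNorm N (taylor (initialSum n α k) P) / n k) := by
  rw [expChar_eval_ipSum hdiv]
  set c := initialSum n α k
  by_cases hk : k ∈ α
  · have hmem' := coeffVec_taylor_mem h (index_dvd_initialSum hidx α k) hP hmem
    have := norm_expChar_eval_sub_le ψ (P := taylor c P) (by rwa [natDegree_taylor])
    rw [(QuotientAddGroup.eq_zero_iff _).2 (le_sup_left (a := prodZero h G) hmem'),
      AddChar.map_zero_eq_one, taylor_eval, add_comm, mul_div_assoc] at this
    rwa [if_pos hk]
  · rw [if_neg hk, add_zero]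
    refine (norm_expChar_sub_one_le _).trans ?_
    rw [mul_assoc (2 * Real.pi)]
    refine mul_le_mul_of_nonneg_left ?_ Real.two_pi_pos.le
    rw [abs_mul, abs_of_nonneg (digitPoint_nonneg ψ), mul_div_left_comm, ← taylor_coeff_zero]
    exact mul_le_mul (abs_coeff_le_coeffNorm (Nat.zero_le N) _) (digitPoint_le ψ)
      (digitPoint_nonneg ψ) (coeffNorm_nonneg _ _)

theorem norm_expChar_eval_ipSum_digitSum_sub_one_le
    (hdiv : ∀ k i, k < i → n k ^ (N + 1) ∣ n i)
    (hidx : ∀ k, G.index ∣ n k) (hs : Summable (growthRatio N n)) {P : ℤ[X]}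
    (hP : P.natDegree ≤ N) (hP0 : P.coeff 0 = 0) (hmem : coeffVec N P ∈ prodZero h G) :
    ∃ C : ℝ, ∀ (α : FinNonempty) (ω : ∀ k, DualMod (prodZero h G) (n k)),
      ‖expChar ((P.eval (∑ i ∈ α.1, (n i : ℤ)) : ℤ) * digitSum ω) - 1‖ ≤
        C * ∑' k, growthRatio N n (k + α.1.min' α.2) := by
  obtain ⟨C, hC, hCP⟩ := exists_coeffNorm_taylor_le hP
  refine ⟨2 * Real.pi * N * C, fun α ω => ?_⟩
  set m := α.1.min' α.2 with hm
  set q := P.eval (∑ i ∈ α.1, (n i : ℤ))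
  have hlim := ((tendsto_prod_expChar (summable_one_div_of_growthRatio hs) q ω).comp
    (tendsto_add_atTop_nat m)).sub_const 1
  refine le_of_tendsto hlim.norm (Eventually.of_forall fun K => ?_)
  -- Before `min α` the sum `n_α` is 0 mod `n k ^ (N + 1)`, and `P` has no constant term, so these
  -- factors are exactly 1.
  have hone : ∏ k ∈ Finset.range m, expChar (q * digitPoint (ω k)) = 1 := by
    refine Finset.prod_eq_one fun k hk => ?_
    have hkm := Finset.mem_range.1 hk
    rw [expChar_eval_ipSum hdiv, initialSum_of_le_min' α hkm.le,
      if_neg fun hkα => absurd (α.1.min'_le k hkα) (not_le.2 hkm), add_zero,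
      ← coeff_zero_eq_eval_zero, hP0]
    simp
  simp only [Function.comp_apply]
  rw [add_comm K m, Finset.prod_range_add, hone, one_mul]
  refine (norm_prod_sub_one_le _ _ fun _ _ => norm_expChar _).trans ?_
  have hs' : Summable fun k => growthRatio N n (k + m) := (summable_nat_add_iff m).2 hs
  rw [← tsum_mul_left]
  refine le_trans (Finset.sum_le_sum fun k _ => ?_)
    ((hs'.mul_left (2 * Real.pi * N * C)).sum_le_tsum (Finset.range K) fun k _ => ?_)
  · refine (norm_expChar_eval_ipSum_sub_one_le hdiv hidx hP hmem α.1 (m + k) _).trans ?_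
    rw [mul_assoc (2 * Real.pi * N), add_comm k m]
    exact mul_le_mul_of_nonneg_left (coeffNorm_taylor_initialSum_le hC hCP _ _)
      (by positivity)
  · rw [growthRatio]
    positivity

/-- Splitting off the constant term leaves a factor that tends to 1 uniformly in ω, at the rate of a
tail of the growth series. -/
theorem tendsto_integral_expChar_of_mem (hdiv : ∀ k i, k < i → n k ^ (N + 1) ∣ n i)
    (hidx : ∀ k, G.index ∣ n k) (hs : Summable (growthRatio N n)) {P : ℤ[X]}
    (hP : P.natDegree ≤ N) (hmem : coeffVec N P ∈ prodZero h G) :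
    Tendsto (fun α : FinNonempty => ∫ ω, expChar ((P.eval (∑ i ∈ α.1, (n i : ℤ)) : ℤ) * digitSum ω)
        ∂(sequenceMeasure (prodZero h G) n)) ipFilter
      (𝓝 (∫ ω, expChar (P.coeff 0 * digitSum ω) ∂(sequenceMeasure (prodZero h G) n))) := by
  have hn := summable_one_div_of_growthRatio hs
  set P₀ := P - C (P.coeff 0) with hP₀
  have hP₀deg : P₀.natDegree ≤ N := by rwa [hP₀, natDegree_sub_C]
  have hP₀mem : coeffVec N P₀ ∈ prodZero h G := by
    convert hmem using 1
    funext j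
    simp only [coeffVec, hP₀]
    rw [coeff_sub, coeff_C_succ, sub_zero]
  obtain ⟨B, hB⟩ := norm_expChar_eval_ipSum_digitSum_sub_one_le hdiv hidx hs hP₀deg
    (by simp [hP₀]) hP₀mem
  have hint : ∀ q : ℤ, Integrable (fun ω : (∀ k, DualMod (prodZero h G) (n k)) =>
      expChar (q * digitSum ω)) (sequenceMeasure (prodZero h G) n) := fun q =>
    Integrable.of_bound (continuous_expChar.measurable.comp
      ((measurable_digitSum hn).const_mul _)).aestronglyMeasurable 1
      (Eventually.of_forall fun ω => (norm_expChar _).le)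
  rw [tendsto_iff_norm_sub_tendsto_zero]
  have hlim : Tendsto (fun α : FinNonempty =>
      B * ∑' k, growthRatio N n (k + α.1.min' α.2)) ipFilter (𝓝 0) := by
    simpa using (((tendsto_sum_nat_add (growthRatio N n)).comp tendsto_min'_ipFilter).const_mul B)
  refine squeeze_zero (fun _ => norm_nonneg _) (fun α => ?_) hlim
  rw [← integral_sub (hint _) (hint _)]
  refine (norm_integral_le_of_norm_le_const (Eventually.of_forall fun ω => ?_)).trans
    (by rw [probReal_univ, mul_one])
  have : (P.eval (∑ i ∈ α.1, (n i : ℤ)) : ℤ) =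
      P₀.eval (∑ i ∈ α.1, (n i : ℤ)) + P.coeff 0 := by simp [hP₀]
  rw [this]
  push_cast
  rw [add_mul, expChar_add, ← sub_one_mul, norm_mul, norm_expChar, mul_one]
  exact_mod_cast hB α ω

/-- One factor suffices. At `l = max α` the sum is exactly `n l + c`, and the approximating
character has mean zero. -/
theorem tendsto_integral_expChar_of_notMem (hidx : ∀ k, G.index ∣ n k)
    (hs : Summable (growthRatio N n)) {P : ℤ[X]}
    (hP : P.natDegree ≤ N) (hmem : coeffVec N P ∉ prodZero h G) :
    Tendsto (fun α : FinNonempty => ∫ ω, expChar ((P.eval (∑ i ∈ α.1, (n i : ℤ)) : ℤ) * digitSum ω)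
        ∂(sequenceMeasure (prodZero h G) n)) ipFilter (𝓝 0) := by
  have hn := summable_one_div_of_growthRatio hs
  obtain ⟨C, hC, hCP⟩ := exists_coeffNorm_taylor_le hP
  have hmax : Tendsto (fun α : FinNonempty => growthRatio N n (α.1.max' α.2)) ipFilter (𝓝 0) :=
    hs.tendsto_atTop_zero.comp tendsto_max'_ipFilter
  have hlim : Tendsto (fun α : FinNonempty =>
      2 * Real.pi * N * (C * growthRatio N n (α.1.max' α.2))) ipFilter (𝓝 0) := by
    simpa using (hmax.const_mul C).const_mul (2 * Real.pi * N)
  -- This keeps the shifted coefficients below `n l`, so that lying outside `prodZero h G` implies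
  -- lying outside the thickened subgroup.
  have hsmall : ∀ᶠ α : FinNonempty in ipFilter, C * growthRatio N n (α.1.max' α.2) < 1 :=
    (by simpa using hmax.const_mul C : Tendsto _ _ (𝓝 (0 : ℝ))).eventually_lt_const one_pos
  refine squeeze_zero_norm' (hsmall.mono fun α hα => ?_) hlim
  set l := α.1.max' α.2 with hl
  refine (norm_integral_expChar_digitSum_le hn _ l).trans ?_
  set c := initialSum n α.1 l with hc
  have hsum : (∑ i ∈ α.1, (n i : ℤ)) = n l + c := by
    rw [hc, initialSum, ← Finset.add_sum_erase _ _ (α.1.max'_mem α.2)]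
    congr 2
    ext i
    simp only [Finset.mem_erase, Finset.mem_filter]
    constructor
    · rintro ⟨h1, h2⟩
      exact ⟨h2, lt_of_le_of_ne (α.1.le_max' i h2) h1⟩
    · rintro ⟨h1, h2⟩
      exact ⟨h2.ne, h1⟩
  have hbound := coeffNorm_taylor_initialSum_le (n := n) hC hCP α.1 l
  have hpos : (0 : ℝ) < n l := by exact_mod_cast NeZero.pos (n l)
  have hnot : coeffVec N (taylor c P) ∉ thicken (prodZero h G) (n l) := by
    intro hm
    rw [← coeffVec_taylor_mem_iff h (index_dvd_initialSum hidx α.1 l) hP] at hmem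
    refine hmem (mem_of_mem_thicken h (hidx l) (fun j => ?_) hm)
    have h1 : |((coeffVec N (taylor c P) j : ℤ) : ℝ)| < n l :=
      (abs_coeff_le_coeffNorm j.2 _).trans_lt ((div_lt_one hpos).1 (hbound.trans_lt hα))
    exact_mod_cast h1
  have hz := integral_dualMeasure_apply hnot
  have hint : ∀ g : DualMod (prodZero h G) (n l) → ℂ,
      Integrable g (dualMeasure (prodZero h G) (n l)) := fun g => Integrable.of_finite
  -- Subtracting the vanishing mean of ψ leaves only the approximation error.
  rw [← sub_zero (∫ ψ, _ ∂_), ← hz, ← integral_sub (hint _) (hint _)]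
  refine (norm_integral_le_of_norm_le_const (Eventually.of_forall fun ψ => ?_)).trans
    (by rw [probReal_univ, mul_one])
  rw [hsum, ← taylor_eval]
  refine (norm_expChar_eval_sub_le ψ (by rwa [natDegree_taylor])).trans ?_
  rw [mul_div_assoc]
  exact mul_le_mul_of_nonneg_left hbound (by positivity)

end ipSum

/-! ### A rapidly growing sequence -/

/-- The sequence `k ↦ (2 M) ^ ((N + 2) ^ k)`. -/
def rapidSeq (M N k : ℕ) : ℕ := (2 * M) ^ ((N + 2) ^ k)

section rapidSeq

variable {M N : ℕ}

theorem rapidSeq_succ (k : ℕ) : rapidSeq M N (k + 1) = rapidSeq M N k ^ (N + 2) := by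
  rw [rapidSeq, rapidSeq, ← pow_mul, ← pow_succ]

theorem dvd_rapidSeq (k : ℕ) : M ∣ rapidSeq M N k :=
  (Dvd.intro_left 2 rfl).trans (dvd_pow_self _ (by positivity))

theorem rapidSeq_pow_dvd {k i : ℕ} (h : k < i) :
    rapidSeq M N k ^ (N + 1) ∣ rapidSeq M N i := by
  rw [rapidSeq, rapidSeq, ← pow_mul]
  refine pow_dvd_pow _ ?_
  calc (N + 2) ^ k * (N + 1) ≤ (N + 2) ^ k * (N + 2) := Nat.mul_le_mul_left _ (by omega)
    _ = (N + 2) ^ (k + 1) := (pow_succ _ _).symm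
    _ ≤ (N + 2) ^ i := Nat.pow_le_pow_right (by omega) h

variable (hM : 0 < M)
include hM

theorem strictMono_rapidSeq : StrictMono (rapidSeq M N) :=
  -- The factor 2 in the base matters when `M = 1`, that is when `G` is all of `ℤ^d`.
  (pow_right_strictMono₀ (show 1 < 2 * M by omega)).comp
    (pow_right_strictMono₀ (show 1 < N + 2 by omega))

theorem rapidSeq_pos (k : ℕ) : 0 < rapidSeq M N k := by unfold rapidSeq; positivity

theorem two_mul_rapidSeq_le (k : ℕ) : 2 * rapidSeq M N k ≤ rapidSeq M N (k + 1) := by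
  have h2 : 2 ≤ rapidSeq M N k := by
    rw [rapidSeq]
    calc 2 ≤ 2 * M := by omega
      _ ≤ (2 * M) ^ ((N + 2) ^ k) := Nat.le_self_pow (by positivity) _
  rw [rapidSeq_succ, pow_succ]
  calc 2 * rapidSeq M N k ≤ rapidSeq M N k * rapidSeq M N k := Nat.mul_le_mul_right _ h2
    _ ≤ _ := Nat.mul_le_mul_right _ (Nat.le_self_pow (by omega) _)

theorem two_pow_le_rapidSeq (k : ℕ) : 2 ^ k ≤ rapidSeq M N k := by
  induction k with
  | zero => exact rapidSeq_pos hM 0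
  | succ k ih => rw [pow_succ]; linarith [two_mul_rapidSeq_le (N := N) hM k]

theorem one_add_sum_rapidSeq_le (k : ℕ) :
    1 + ∑ i ∈ Finset.range (k + 1), rapidSeq M N i ≤ 2 * rapidSeq M N k := by
  induction k with
  | zero => have := rapidSeq_pos (N := N) hM 0; simp; omega
  | succ k ih =>
    rw [Finset.sum_range_succ]
    linarith [two_mul_rapidSeq_le (N := N) hM k]

/-- The ratio at `k + 1` is at most `(2 n_k)^N / n_k^(N+2) = 2^N / n_k^2`, which is dominated by a
geometric series. -/
theorem summable_growthRatio_rapidSeq : Summable (growthRatio N (rapidSeq M N)) := by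
  rw [← summable_nat_add_iff 1]
  refine Summable.of_nonneg_of_le (fun k => by rw [growthRatio]; positivity) (fun k => ?_)
    ((summable_geometric_of_lt_one (r := (1 / 2 : ℝ)) (by norm_num) (by norm_num)).mul_left (2 ^ N))
  have h1 : (1 + ∑ i ∈ Finset.range (k + 1), (rapidSeq M N i : ℝ)) ≤ 2 * rapidSeq M N k := by
    exact_mod_cast one_add_sum_rapidSeq_le (N := N) hM k
  have h2 : (2 : ℝ) ^ k ≤ rapidSeq M N k := by exact_mod_cast two_pow_le_rapidSeq (N := N) hM k
  have h0 : (1 : ℝ) ≤ rapidSeq M N k := by exact_mod_cast rapidSeq_pos (N := N) hM k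
  have hpos : (0 : ℝ) < rapidSeq M N k := by linarith
  rw [growthRatio, rapidSeq_succ]
  push_cast
  rw [div_le_iff₀ (by positivity)]
  refine (pow_le_pow_left₀ (by positivity) h1 N).trans ?_
  rw [mul_pow, mul_assoc, pow_add, one_div, inv_pow]
  refine mul_le_mul_of_nonneg_left ?_ (by positivity)
  rw [inv_mul_eq_div, le_div_iff₀ (by positivity)]
  refine mul_le_mul_of_nonneg_left ?_ (by positivity)
  exact h2.trans (le_self_pow₀ h0 two_ne_zero)

end rapidSeq

/-! ### Characters and Haar measure of the annihilator -/

theorem mFourier_apply_eq_toCircle {N : ℕ} (a : Fin N → ℤ) (y : Torus N) :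
    UnitAddTorus.mFourier a y = (AddCircle.toCircle (∑ j, a j • y j) : ℂ) := by
  have hsum : ∀ (s : Finset (Fin N)) (x : Fin N → UnitAddCircle),
      AddCircle.toCircle (∑ j ∈ s, x j) = ∏ j ∈ s, AddCircle.toCircle (x j) := by
    intro s x
    induction s using Finset.induction_on with
    | empty => simp
    | insert i s hi ih =>
      rw [Finset.sum_insert hi, Finset.prod_insert hi, AddCircle.toCircle_add, ih]
  rw [hsum]
  exact (map_prod Circle.coeHom (fun j => AddCircle.toCircle (a j • y j)) Finset.univ).symm

theorem fourier_coe_eq_expChar (m : ℤ) (t : ℝ) :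
    fourier m (t : UnitAddCircle) = expChar (m * t) := by
  rw [fourier_coe_apply, expChar]
  push_cast
  ring_nf

theorem mFourier_coe_eq_expChar {N : ℕ} (a : Fin N → ℤ) (t : Fin N → ℝ) :
    UnitAddTorus.mFourier a (fun j => (t j : UnitAddCircle)) = expChar (∑ j, a j * t j) := by
  rw [expChar_sum]
  change ∏ j, fourier (a j) (t j : UnitAddCircle) = _
  exact Finset.prod_congr rfl fun j _ => fourier_coe_eq_expChar (a j) (t j)

instance isProbabilityMeasure_haarAnnihilator {N : ℕ} (H : AddSubgroup (Fin N → ℤ)) :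
    IsProbabilityMeasure (haarAnnihilator H) := by
  have : IsProbabilityMeasure
      (Measure.addHaarMeasure (⊤ : TopologicalSpace.PositiveCompacts (annihilator H))) :=
    ⟨Measure.addHaarMeasure_self⟩
  exact Measure.isProbabilityMeasure_map measurable_subtype_coe.aemeasurable

/-- A character of a finite quotient that detects `a` gives the point with coordinates `residue ψ j
/ n`. -/
theorem exists_mem_annihilator_mFourier_ne_one {d N : ℕ} (h : d ≤ N) {G : AddSubgroup (Fin d → ℤ)}
    (hG : G.FiniteIndex) {a : Fin N → ℤ} (ha : a ∉ prodZero h G) :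
    ∃ y ∈ annihilator (prodZero h G), UnitAddTorus.mFourier a y ≠ 1 := by
  have hpos : 0 < G.index := Nat.pos_of_ne_zero hG.index_ne_zero
  -- A multiple of the index exceeding every `|a j|`, as `mem_of_mem_thicken` requires.
  set n := G.index * (∑ j, (a j).natAbs + 1) with hn
  have : NeZero n := ⟨by positivity⟩
  have hlt : ∀ j, |a j| < n := by
    intro j
    have h1 : (a j).natAbs ≤ ∑ j, (a j).natAbs :=
      Finset.single_le_sum (f := fun j => (a j).natAbs) (fun _ _ => Nat.zero_le _)
        (Finset.mem_univ j)
    have h2 : ∑ j, (a j).natAbs + 1 ≤ n := Nat.le_mul_of_pos_left _ hpos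
    rw [Int.abs_eq_natAbs]
    exact_mod_cast (by omega : (a j).natAbs < n)
  have hnot : (a : (Fin N → ℤ) ⧸ thicken (prodZero h G) n) ≠ 0 := fun h0 =>
    ha (mem_of_mem_thicken h (Dvd.intro _ rfl) hlt ((QuotientAddGroup.eq_zero_iff _).1 h0))
  obtain ⟨ψ, hψ⟩ := AddChar.exists_apply_ne_zero.2 hnot
  have key : ∀ b : Fin N → ℤ, UnitAddTorus.mFourier b
      (fun j => ((residue ψ j / n : ℝ) : UnitAddCircle)) =
        ψ (b : (Fin N → ℤ) ⧸ thicken (prodZero h G) n) := fun b => by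
    rw [mFourier_coe_eq_expChar, apply_eq_expChar_residue]
  refine ⟨fun j => ((residue ψ j / n : ℝ) : UnitAddCircle), fun b hb => ?_, by rwa [key]⟩
  rw [← Circle.coe_inj, ← mFourier_apply_eq_toCircle, key,
    (QuotientAddGroup.eq_zero_iff _).2 (le_sup_left (a := prodZero h G) hb),
    AddChar.map_zero_eq_one, Circle.coe_one]

open Classical in
-- Outside the subgroup, translation by a point where the character is not 1 multiplies the integral
-- by a number other than 1 and leaves it unchanged.
theorem integral_mFourier_haarAnnihilator {d N : ℕ} (h : d ≤ N) {G : AddSubgroup (Fin d → ℤ)}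
    (hG : G.FiniteIndex) (a : Fin N → ℤ) :
    ∫ y, UnitAddTorus.mFourier a y ∂(haarAnnihilator (prodZero h G)) =
      if a ∈ prodZero h G then 1 else 0 := by
  split_ifs with ha
  · have hone : ∀ᵐ y ∂(haarAnnihilator (prodZero h G)), UnitAddTorus.mFourier a y = 1 := by
      have hms : MeasurableSet {y : Torus N | UnitAddTorus.mFourier a y = 1} :=
        (isClosed_eq (UnitAddTorus.mFourier a).continuous continuous_const).measurableSet
      rw [haarAnnihilator, ae_map_iff measurable_subtype_coe.aemeasurable hms]
      refine Eventually.of_forall fun y => ?_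
      rw [mFourier_apply_eq_toCircle, y.2 a ha, Circle.coe_one]
    rw [integral_congr_ae hone]
    simp
  · obtain ⟨y₀, hy₀, hne⟩ := exists_mem_annihilator_mFourier_ne_one h hG ha
    rw [haarAnnihilator, integral_map measurable_subtype_coe.aemeasurable
      (UnitAddTorus.mFourier a).continuous.measurable.aestronglyMeasurable]
    set μ := Measure.addHaarMeasure
      (⊤ : TopologicalSpace.PositiveCompacts (annihilator (prodZero h G)))
    have hinv := integral_add_left_eq_self (μ := μ)
      (fun y : annihilator (prodZero h G) => UnitAddTorus.mFourier a (y : Torus N)) ⟨y₀, hy₀⟩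
    have hmul : ∀ y : annihilator (prodZero h G),
        UnitAddTorus.mFourier a (((⟨y₀, hy₀⟩ + y : annihilator (prodZero h G)) : Torus N)) =
          UnitAddTorus.mFourier a y₀ * UnitAddTorus.mFourier a (y : Torus N) := by
      intro y
      simp only [mFourier_apply_eq_toCircle, AddSubgroup.coe_add, Pi.add_apply, smul_add,
        Finset.sum_add_distrib, AddCircle.toCircle_add, Circle.coe_mul]
    simp only [hmul] at hinv
    rw [integral_const_mul] at hinv
    have : (UnitAddTorus.mFourier a y₀ - 1) *
        ∫ y, UnitAddTorus.mFourier a ((y : annihilator (prodZero h G)) : Torus N) ∂μ = 0 := by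
      rw [sub_mul, hinv, one_mul, sub_self]
    exact (mul_eq_zero.1 this).resolve_left (sub_ne_zero.2 hne)

/-! ### Density -/

/-- The uniform bound makes the set of vectors with limit zero a closed subspace. -/
theorem tendsto_zero_of_span_dense {V ι : Type*} [SeminormedAddCommGroup V] [NormedSpace ℂ V]
    {F : Filter ι} (T : ι → V →ₗ[ℂ] ℂ) (B : ℝ) (hB : ∀ i v, ‖T i v‖ ≤ B * ‖v‖) {s : Set V}
    (hs : (Submodule.span ℂ s).topologicalClosure = ⊤)
    (h : ∀ v ∈ s, Tendsto (fun i => T i v) F (𝓝 0)) (v : V) :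
    Tendsto (fun i => T i v) F (𝓝 0) := by
  have hspan : ∀ w ∈ Submodule.span ℂ s, Tendsto (fun i => T i w) F (𝓝 0) := by
    intro w hw
    induction hw using Submodule.span_induction with
    | mem x hx => exact h x hx
    | zero => simpa using tendsto_const_nhds
    | add x y _ _ hx hy => simpa using hx.add hy
    | smul c x _ hx => simpa using hx.const_mul c
  have hv : v ∈ closure (Submodule.span ℂ s : Set V) := by
    rw [← Submodule.topologicalClosure_coe, hs]; trivial
  rw [Metric.tendsto_nhds]
  intro ε hε
  obtain ⟨w, hw, hvw⟩ := Metric.mem_closure_iff.1 hv (ε / 2 / (|B| + 1)) (by positivity)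
  filter_upwards [Metric.tendsto_nhds.1 (hspan w hw) (ε / 2) (by positivity)] with i hi
  rw [dist_zero_right] at hi ⊢
  rw [dist_eq_norm, lt_div_iff₀ (by positivity)] at hvw
  have h1 : ‖T i (v - w)‖ ≤ ‖v - w‖ * (|B| + 1) := by
    rw [mul_comm]
    exact (hB i _).trans
      (mul_le_mul_of_nonneg_right (by linarith [le_abs_self B]) (norm_nonneg _))
  calc ‖T i v‖ = ‖T i (v - w) + T i w‖ := by rw [map_sub, sub_add_cancel]
    _ ≤ ‖T i (v - w)‖ + ‖T i w‖ := norm_add_le _ _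
    _ < ε := by linarith

/-- The point `(n x, n² x, …, n^N x)` of the torus. -/
def powerOrbit (N n : ℕ) (x : UnitAddCircle) : Torus N := fun j => (n ^ ((j : ℕ) + 1)) • x

theorem continuous_powerOrbit (N n : ℕ) : Continuous (powerOrbit N n) :=
  continuous_pi fun _ => continuous_nsmul _

section correlation

variable {N : ℕ} (σ : Measure UnitAddCircle) (μ : Measure (Torus N))

/-- The difference `∫ g(x) f(n x, …, n^N x) dσ(x) - ∫ g dσ ∫ f dμ`. -/
def correlation (n : ℕ) (g : UnitAddCircle → ℂ) (f : Torus N → ℂ) : ℂ :=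
  ∫ x, g x * f (powerOrbit N n x) ∂σ - (∫ x, g x ∂σ) * ∫ y, f y ∂μ

variable {σ μ}

theorem integrable_mul_comp_powerOrbit {g : UnitAddCircle → ℂ} (hg : Integrable g σ)
    (n : ℕ) (f : C(Torus N, ℂ)) : Integrable (fun x => g x * f (powerOrbit N n x)) σ :=
  hg.mul_bdd (c := ‖f‖)
    (f.continuous.comp (continuous_powerOrbit N n)).measurable.aestronglyMeasurable
    (Eventually.of_forall fun _ => f.norm_coe_le_norm _)

theorem integrable_continuousMap {X : Type*} [TopologicalSpace X] [CompactSpace X]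
    [MeasurableSpace X] [BorelSpace X] [SecondCountableTopology X] (ν : Measure X)
    [IsProbabilityMeasure ν] (f : C(X, ℂ)) : Integrable f ν :=
  Integrable.of_bound f.continuous.measurable.aestronglyMeasurable ‖f‖
    (Eventually.of_forall fun _ => f.norm_coe_le_norm _)

theorem norm_correlation_le [IsProbabilityMeasure μ] {g : UnitAddCircle → ℂ} (hg : Integrable g σ)
    (n : ℕ) (f : C(Torus N, ℂ)) :
    ‖correlation σ μ n g f‖ ≤ 2 * (∫ x, ‖g x‖ ∂σ) * ‖f‖ := by
  have h1 : ‖∫ x, g x * f (powerOrbit N n x) ∂σ‖ ≤ (∫ x, ‖g x‖ ∂σ) * ‖f‖ := by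
    rw [← integral_mul_const]
    refine norm_integral_le_of_norm_le (hg.norm.mul_const _) (Eventually.of_forall fun x => ?_)
    rw [norm_mul]
    exact mul_le_mul_of_nonneg_left (f.norm_coe_le_norm _) (norm_nonneg _)
  have h2 : ‖(∫ x, g x ∂σ) * ∫ y, f y ∂μ‖ ≤ (∫ x, ‖g x‖ ∂σ) * ‖f‖ := by
    rw [norm_mul]
    refine mul_le_mul (norm_integral_le_integral_norm _) ?_ (norm_nonneg _)
      (integral_nonneg fun _ => norm_nonneg _)
    refine (norm_integral_le_of_norm_le_const (Eventually.of_forall fun y =>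
      f.norm_coe_le_norm y)).trans (by rw [probReal_univ, mul_one])
  refine (norm_sub_le _ _).trans ?_
  linarith

theorem correlation_add_left {g g' : UnitAddCircle → ℂ} (hg : Integrable g σ)
    (hg' : Integrable g' σ) (n : ℕ) (f : C(Torus N, ℂ)) :
    correlation σ μ n (g + g') f = correlation σ μ n g f + correlation σ μ n g' f := by
  simp only [correlation, Pi.add_apply, add_mul]
  rw [integral_add (integrable_mul_comp_powerOrbit hg n f) (integrable_mul_comp_powerOrbit hg' n f),
    integral_add hg hg']
  ring

theorem correlation_add_right [IsProbabilityMeasure μ] {g : UnitAddCircle → ℂ} (hg : Integrable g σ) (n : ℕ)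
    (f f' : C(Torus N, ℂ)) :
    correlation σ μ n g (f + f') = correlation σ μ n g f + correlation σ μ n g f' := by
  simp only [correlation, Pi.add_apply, mul_add]
  rw [integral_add (integrable_mul_comp_powerOrbit hg n f) (integrable_mul_comp_powerOrbit hg n f'),
    integral_add (integrable_continuousMap μ f) (integrable_continuousMap μ f')]
  ring

theorem correlation_smul_left (c : ℂ) (g : UnitAddCircle → ℂ) (n : ℕ) (f : Torus N → ℂ) :
    correlation σ μ n (c • g) f = c * correlation σ μ n g f := by
  simp only [correlation, Pi.smul_apply, smul_eq_mul, mul_assoc, integral_const_mul]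
  ring

theorem correlation_smul_right (c : ℂ) (g : UnitAddCircle → ℂ) (n : ℕ) (f : Torus N → ℂ) :
    correlation σ μ n g (c • f) = c * correlation σ μ n g f := by
  simp only [correlation, Pi.smul_apply, smul_eq_mul, mul_left_comm _ c, integral_const_mul]
  ring

/-- The bound `2 ‖g‖₁ ‖f‖` allows three approximations in turn: `f` uniformly by characters,
continuous `g` uniformly by characters, then integrable `g` in L¹ by continuous functions. -/
theorem tendsto_correlation_of_fourier [IsProbabilityMeasure σ] [IsProbabilityMeasure μ] {ι : Type*} {F : Filter ι}
    {n : ι → ℕ} (h : ∀ (m : ℤ) (a : Fin N → ℤ), Tendsto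
      (fun i => correlation σ μ (n i) (fourier m) (UnitAddTorus.mFourier a)) F (𝓝 0))
    {g : UnitAddCircle → ℂ} (hg : Integrable g σ) (f : C(Torus N, ℂ)) :
    Tendsto (fun i => correlation σ μ (n i) g f) F (𝓝 0) := by
  have h1 : ∀ (m : ℤ) (f : C(Torus N, ℂ)),
      Tendsto (fun i => correlation σ μ (n i) (fourier m) f) F (𝓝 0) := by
    intro m f
    have hm : Integrable (fourier m : C(UnitAddCircle, ℂ)) σ := integrable_continuousMap σ _
    refine tendsto_zero_of_span_dense (V := C(Torus N, ℂ))
      (fun i =>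
        { toFun := fun f => correlation σ μ (n i) (fourier m) f
          map_add' := fun f f' => correlation_add_right hm (n i) f f'
          map_smul' := fun c f => correlation_smul_right c _ (n i) f })
      (2 * ∫ x, ‖fourier m x‖ ∂σ) (fun i f => norm_correlation_le hm (n i) f)
      UnitAddTorus.span_mFourier_closure_eq_top ?_ f
    rintro _ ⟨a, rfl⟩
    exact h m a
  have h2 : ∀ g : C(UnitAddCircle, ℂ), Tendsto (fun i => correlation σ μ (n i) g f) F (𝓝 0) := by
    intro g
    refine tendsto_zero_of_span_dense (V := C(UnitAddCircle, ℂ))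
      (fun i =>
        { toFun := fun g => correlation σ μ (n i) g f
          map_add' := fun g g' => correlation_add_left (integrable_continuousMap σ g)
            (integrable_continuousMap σ g') (n i) f
          map_smul' := fun c g => correlation_smul_left c g (n i) f })
      (2 * ‖f‖) (fun i g => ?_) (span_fourier_closure_eq_top (T := 1)) ?_ g
    · refine (norm_correlation_le (integrable_continuousMap σ g) (n i) f).trans ?_
      have : ∫ x, ‖g x‖ ∂σ ≤ ‖g‖ :=
        (integral_mono (integrable_continuousMap σ g).norm (integrable_const _)
          fun x => g.norm_coe_le_norm x).trans (by simp)
      nlinarith [norm_nonneg f]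
    · rintro _ ⟨m, rfl⟩
      exact h1 m f
  rw [Metric.tendsto_nhds]
  intro ε hε
  obtain ⟨g', hg', hint⟩ := hg.exists_boundedContinuous_integral_sub_le
    (show 0 < ε / 2 / (2 * ‖f‖ + 1) by positivity)
  filter_upwards [Metric.tendsto_nhds.1 (h2 g'.toContinuousMap) (ε / 2) (by positivity)] with i hi
  rw [dist_zero_right] at hi ⊢
  have h3 := norm_correlation_le (μ := μ) (hg.sub hint) (n i) f
  have h4 := correlation_add_left (μ := μ) (hg.sub hint) hint (n i) f
  rw [sub_add_cancel] at h4
  rw [le_div_iff₀ (by positivity)] at hg'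
  have h5 : 0 ≤ ∫ x, ‖g x - g' x‖ ∂σ := integral_nonneg fun _ => norm_nonneg _
  rw [h4]
  refine (norm_add_le _ _).trans_lt ?_
  have hi' : ‖correlation σ μ (n i) (g' : UnitAddCircle → ℂ) f‖ < ε / 2 := hi
  simp only [Pi.sub_apply] at h3
  linarith

end correlation

/-! ### The limit for characters -/

/-- The law of the random series, as a measure on the circle. -/
def circleMeasure {N : ℕ} (H : AddSubgroup (Fin N → ℤ)) (n : ℕ → ℕ) [∀ k, NeZero (n k)] :
    Measure UnitAddCircle :=
  (sequenceMeasure H n).map fun ω => (digitSum ω : UnitAddCircle)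

section circleMeasure

variable {d N : ℕ} {h : d ≤ N} {G : AddSubgroup (Fin d → ℤ)} {n : ℕ → ℕ} [∀ k, NeZero (n k)]

theorem measurable_coe_digitSum {H : AddSubgroup (Fin N → ℤ)}
    (hn : Summable fun k => (1 : ℝ) / n k) :
    Measurable fun ω : (∀ k, DualMod H (n k)) => (digitSum ω : UnitAddCircle) :=
  (AddCircle.continuous_mk' (1 : ℝ)).measurable.comp (measurable_digitSum hn)

theorem isProbabilityMeasure_circleMeasure (H : AddSubgroup (Fin N → ℤ))
    (hn : Summable fun k => (1 : ℝ) / n k) : IsProbabilityMeasure (circleMeasure H n) :=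
  Measure.isProbabilityMeasure_map (measurable_coe_digitSum hn).aemeasurable

/-- Merges both characters into one polynomial phase, with `m` as its constant term. -/
theorem integral_fourier_mul_mFourier_powerOrbit {H : AddSubgroup (Fin N → ℤ)}
    (hn : Summable fun k => (1 : ℝ) / n k) (m : ℤ) (a : Fin N → ℤ) (q : ℕ) :
    ∫ x, fourier m x * UnitAddTorus.mFourier a (powerOrbit N q x) ∂(circleMeasure H n) =
      ∫ ω, expChar (((C m + ∑ j : Fin N, C (a j) * X ^ ((j : ℕ) + 1) : ℤ[X]).eval (q : ℤ) : ℤ) *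
        digitSum ω) ∂(sequenceMeasure H n) := by
  have hcont : Continuous fun x => fourier m x * UnitAddTorus.mFourier a (powerOrbit N q x) :=
    (fourier m).continuous.mul
      ((UnitAddTorus.mFourier a).continuous.comp (continuous_powerOrbit N q))
  rw [circleMeasure, integral_map (measurable_coe_digitSum hn).aemeasurable
    hcont.measurable.aestronglyMeasurable]
  refine integral_congr_ae (Eventually.of_forall fun ω => ?_)
  have horb : powerOrbit N q (digitSum ω : UnitAddCircle) =
      fun j : Fin N => ((((q : ℝ) ^ ((j : ℕ) + 1)) * digitSum ω : ℝ) : UnitAddCircle) := by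
    funext j
    rw [powerOrbit, ← AddCircle.coe_nsmul]
    simp
  simp only
  rw [horb, mFourier_coe_eq_expChar, fourier_coe_eq_expChar, ← expChar_add]
  congr 1
  simp only [eval_add, eval_C, eval_finsetSum, eval_mul, eval_pow, eval_X]
  push_cast
  rw [add_mul, Finset.sum_mul]
  simp only [mul_assoc]

theorem tendsto_correlation_circleMeasure (hG : G.FiniteIndex)
    (hdiv : ∀ k i, k < i → n k ^ (N + 1) ∣ n i)
    (hidx : ∀ k, G.index ∣ n k) (hs : Summable (growthRatio N n)) (m : ℤ) (a : Fin N → ℤ) :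
    Tendsto (fun α : FinNonempty => correlation (circleMeasure (prodZero h G) n)
      (haarAnnihilator (prodZero h G)) (ipSum n α) (fourier m) (UnitAddTorus.mFourier a))
      ipFilter (𝓝 0) := by
  have hn := summable_one_div_of_growthRatio hs
  set P : ℤ[X] := C m + ∑ j : Fin N, C (a j) * X ^ ((j : ℕ) + 1) with hPdef
  have hdeg : P.natDegree ≤ N := by
    refine natDegree_add_le_of_degree_le (by simp) (natDegree_sum_le_of_forall_le _ _ fun j _ => ?_)
    exact (natDegree_C_mul_X_pow_le _ _).trans j.2
  have hvec : coeffVec N P = a := by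
    funext i
    rw [coeffVec, hPdef, coeff_add, coeff_C_succ, zero_add, finsetSum_coeff,
      Finset.sum_eq_single i]
    · simp
    · intro j _ hj
      rw [coeff_C_mul_X_pow, if_neg]
      exact fun hij => hj (Fin.ext (by omega))
    · simp
  have hP0 : P.coeff 0 = m := by
    rw [coeff_zero_eq_eval_zero, hPdef]
    simp [eval_finsetSum]
  have hcast : ∀ α : FinNonempty, ((ipSum n α : ℕ) : ℤ) = ∑ i ∈ α.1, (n i : ℤ) := fun α => by
    rw [ipSum]; push_cast; rfl
  simp only [correlation, integral_fourier_mul_mFourier_powerOrbit hn, ← hPdef, hcast,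
    integral_mFourier_haarAnnihilator h hG]
  split_ifs with ha
  · have hfour : ∫ x, fourier m x ∂(circleMeasure (prodZero h G) n) =
        ∫ ω, expChar (P.coeff 0 * digitSum ω) ∂(sequenceMeasure (prodZero h G) n) := by
      rw [circleMeasure, integral_map (measurable_coe_digitSum hn).aemeasurable
        (fourier m).continuous.measurable.aestronglyMeasurable, hP0]
      simp only [fourier_coe_eq_expChar]
    rw [hfour, mul_one]
    exact tendsto_sub_nhds_zero_iff.2 (tendsto_integral_expChar_of_mem hdiv hidx hs hdeg
      (by rwa [hvec] : coeffVec N P ∈ prodZero h G))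
  · simpa using tendsto_integral_expChar_of_notMem hidx hs hdeg
      (by rwa [hvec] : coeffVec N P ∉ prodZero h G)

end circleMeasure

end IPRigidity

end

/-! ### Conclusion for the rapidly growing sequence -/

theorem theorem6 (d N : ℕ) (hd : 0 < d) (hdN : d < N)
    (G : AddSubgroup (Fin d → ℤ)) (hG : G.FiniteIndex) :
    ∃ (σ : MeasureTheory.Measure UnitAddCircle) (n : ℕ → ℕ),
      MeasureTheory.IsProbabilityMeasure σ ∧ StrictMono n ∧ (∀ k, 0 < n k) ∧
      ∀ f : IPRigidity.Torus N → ℂ, Continuous f →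
      ∀ E : Set UnitAddCircle, MeasurableSet E →
        IPRigidity.HasIPLim
          (fun α : IPRigidity.FinNonempty =>
            ∫ x, E.indicator (fun _ => (1 : ℂ)) x *
              f (fun j : Fin N => (IPRigidity.ipSum n α ^ ((j : ℕ) + 1)) • x) ∂σ)
          ((σ.real E : ℂ) *
            ∫ y, f y ∂(IPRigidity.haarAnnihilator (IPRigidity.prodZero hdN.le G))) := by
  have hM : 0 < G.index := Nat.pos_of_ne_zero hG.index_ne_zero
  have hne : ∀ k, NeZero (IPRigidity.rapidSeq G.index N k) := fun k =>
    ⟨(IPRigidity.rapidSeq_pos hM k).ne'⟩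
  have hs := IPRigidity.summable_growthRatio_rapidSeq (N := N) hM
  have hprob := IPRigidity.isProbabilityMeasure_circleMeasure (IPRigidity.prodZero hdN.le G)
    (IPRigidity.summable_one_div_of_growthRatio hs)
  refine ⟨IPRigidity.circleMeasure (IPRigidity.prodZero hdN.le G)
    (IPRigidity.rapidSeq G.index N), IPRigidity.rapidSeq G.index N, hprob,
    IPRigidity.strictMono_rapidSeq hM, IPRigidity.rapidSeq_pos hM, fun f hf E hE => ?_⟩
  rw [IPRigidity.hasIPLim_iff_tendsto, ← tendsto_sub_nhds_zero_iff]
  -- The indicator of `E` is merely integrable, which is why the density argument reaches L¹.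
  have hlim := IPRigidity.tendsto_correlation_of_fourier
    (IPRigidity.tendsto_correlation_circleMeasure (h := hdN.le) hG
      (fun _ _ => IPRigidity.rapidSeq_pow_dvd) IPRigidity.dvd_rapidSeq hs)
    ((integrable_const (1 : ℂ)).indicator hE) ⟨f, hf⟩
  refine hlim.congr fun α => ?_
  rw [IPRigidity.correlation, integral_indicator_const _ hE]
  simp only [ContinuousMap.coe_mk, Complex.real_smul, mul_one]
  rfl
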